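/- Let $\mathcal H$ be a complex Hilbert space with inner product $(\cdot,\cdot)_{\mathcal H}$ and let $A$ be a (possibly unbounded) self-adjoint operator in $\mathcal H$ with $A\ge I$. Real powers of $A$ are defined by the functional calculus. For $r\in[0,\infty)$ put $\mathcal V_r(A)=\operatorname{dom}(A^{r/2})$ and let $\mathcal H_r(A)$ be the Hilbert space $\mathcal V_r(A)$ with inner product $(u,v)_{\mathcal H_r(A)}=(A^{r/2}u,A^{r/2}v)_{\mathcal H}$; thus $\mathcal H_0(A)=\mathcal H$ and $\mathcal V_2(A)=\operatorname{dom}(A)$. (i) For each $r\in[0,\infty)$ there is exactly one self-adjoint operator $A_r$ in $\mathcal H_r(A)$ that is a restriction of $A$ (that is, $\operatorname{dom}(A_r)\subseteq\operatorname{dom}(A)$ and $A_ru=Au$ for $u\in\operatorname{dom}(A_r)$). Its domain is $\operatorname{dom}(A_r)=\mathcal V_{r+2}(A)$, so that $A_r=A|_{\mathcal V_{r+2}(A)}$, and $A_0=A$. In particular, $\operatorname{dom}(A_r)\subseteq\operatorname{dom}(A)$ for $r\ge 0$ and $\operatorname{dom}(A_s)\subseteq\operatorname{dom}(A_r)$ for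 $0\le r<s$. If $A$ is unbounded, then $\operatorname{dom}(A_r)\subsetneq\operatorname{dom}(A)$ for $r>0$ and $\operatorname{dom}(A_s)\subsetneq\operatorname{dom}(A_r)$ for $0\le r<s$. (ii) If $A$ is bounded, then for all $r,s\in[0,\infty)$ one has $\mathcal V_r(A)=\mathcal H$ as vector spaces, the norms of $\mathcal H_r(A)$ and $\mathcal H_s(A)$ (in particular, those of $\mathcal H_r(A)$ and $\mathcal H$) are equivalent, and $A_r=A$. (iii) For $r,s,t\in[0,\infty)$ one has $\mathcal V_{r+t}(A)\subseteq\operatorname{dom}(A^{(r-s)/2})$, and $u\mapsto A^{(r-s)/2}u$ is a unitary map from $\mathcal H_{r+t}(A)$ onto $\mathcal H_{s+t}(A)$. For $r,s\in[0,\infty)$, the inverse of the unitary map $A^{(r-s)/2}\colon\mathcal H_r(A)\to\mathcal H_s(A)$ is $A^{-(r-s)/2}$, and $$A^{(r-s)/2}A_rA^{-(r-s)/2}=A_s,\qquad \operatorname{dom}(A_s)=A^{(r-s)/2}\operatorname{dom}(A_r)$$ (equality of operators in $\mathcal H_s(A)$, including domains). Thus $A_r$ in $\mathcal H_r(A)$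 and $A_s$ in $\mathcal H_s(A)$ are unitarily equivalent for all $r,s\in[0,\infty)$; in particular, each $A_r$ is unitarily equivalent to $A$ in $\mathcal H$. Consequently every unitary invariant (every assignment to operators in Hilbert spaces that takes equal values on unitarily equivalent operators) takes the same value on $A$ and on all $A_r$, $r\in[0,\infty)$. -/

import Mathlib

open scoped NNReal InnerProductSpace

universe u v

noncomputable section

namespace LeftDefinite

section Powers

variable {H : Type u} [NormedAddCommGroup H] [InnerProductSpace ℂ H] [CompleteSpace H]

/-- `A` is a (possibly unbounded) self-adjoint operator in `H` and `A ≥ I`, that is,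
`(x, A x) ≥ ‖x‖²` for all `x` in the domain of `A`. -/
structure IsSelfAdjointGeOne (A : H →ₗ.[ℂ] H) : Prop where
  isSelfAdjoint : IsSelfAdjoint A
  ge_one : ∀ x : A.domain, ‖(x : H)‖ ^ 2 ≤ (⟪(x : H), A x⟫_ℂ).re

/-- `A` is bounded on its domain. For a self-adjoint `A` this says `A ∈ 𝓑(H)`; its negation says
that `A` is unbounded. -/
def IsBoundedOp (A : H →ₗ.[ℂ] H) : Prop :=
  ∃ C : ℝ, ∀ x : A.domain, ‖A x‖ ≤ C * ‖(x : H)‖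

open Classical in
/-- The inverse `A⁻¹` as an everywhere defined bounded operator. (It is set to be `0` if there is
no such inverse; for a self-adjoint `A ≥ I` there is one, see `toPMap_boundedInverse`.) -/
def boundedInverse (A : H →ₗ.[ℂ] H) : H →L[ℂ] H :=
  if h : ∃ B : H →L[ℂ] H, (B : H →ₗ[ℂ] H).toPMap ⊤ = A.inverse then h.choose else 0

/-- The real powers `A ^ a` of a self-adjoint operator `A ≥ I`, as operators in `H` with their
natural domain. If `a < 0`, then `A ^ a` is the bounded everywhere defined operator `(A⁻¹) ^ (-a)`;
if `a ≥ 0`, then `A ^ a` is the inverse of the injective bounded operator `(A⁻¹) ^ a`, with the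
range of `(A⁻¹) ^ a` as its domain. The powers of the bounded nonnegative operator `A⁻¹` are those
of the continuous functional calculus. (In a representation of `A` as multiplication by a function
`m ≥ 1`, the operator `(A⁻¹) ^ a` is multiplication by `m ^ (-a)`, and its inverse is the maximal
operator of multiplication by `m ^ a`.) -/
def rpow (A : H →ₗ.[ℂ] H) (a : ℝ) : H →ₗ.[ℂ] H :=
  if 0 ≤ a then
    (((boundedInverse A ^ a : H →L[ℂ] H) : H →ₗ[ℂ] H).toPMap ⊤).inverse
  else
    ((boundedInverse A ^ (-a) : H →L[ℂ] H) : H →ₗ[ℂ] H).toPMap ⊤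

/-- `V_r(A) = dom (A ^ (r / 2))`. -/
def V (A : H →ₗ.[ℂ] H) (r : ℝ≥0) : Submodule ℂ H :=
  (rpow A ((r : ℝ) / 2)).domain

/-! ### Facts needed to see that `H_r(A)` is a Hilbert space -/

lemma norm_le_norm_apply {A : H →ₗ.[ℂ] H} (hA : IsSelfAdjointGeOne A) (x : A.domain) :
    ‖(x : H)‖ ≤ ‖A x‖ := by
  have h1 := hA.ge_one x
  have h2 : (⟪(x : H), A x⟫_ℂ).re ≤ ‖(x : H)‖ * ‖A x‖ :=
    (Complex.re_le_norm _).trans (norm_inner_le_norm _ _)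
  by_cases h0 : ‖(x : H)‖ = 0
  · rw [h0]; positivity
  · have : 0 < ‖(x : H)‖ := lt_of_le_of_ne (norm_nonneg _) (Ne.symm h0)
    nlinarith

lemma ker_eq_bot {A : H →ₗ.[ℂ] H} (hA : IsSelfAdjointGeOne A) : A.toFun.ker = ⊥ := by
  rw [LinearMap.ker_eq_bot']
  intro x hx
  have h := norm_le_norm_apply hA x
  have hx' : A x = 0 := hx
  rw [hx', norm_zero] at h
  exact Subtype.ext (norm_le_zero_iff.mp h)

lemma range_eq_top {A : H →ₗ.[ℂ] H} (hA : IsSelfAdjointGeOne A) : A.toFun.range = ⊤ := by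
  have hdense := hA.isSelfAdjoint.dense_domain
  have hadj : A.adjoint = A := hA.isSelfAdjoint
  -- the range is closed
  have hclosed : IsClosed (A.toFun.range : Set H) := by
    rw [← isSeqClosed_iff_isClosed]
    intro y z hy hyz
    choose x hx using hy
    have hx' : ∀ n, A (x n) = y n := hx
    have hc : CauchySeq (fun n => (x n : H)) := by
      rw [Metric.cauchySeq_iff']
      intro ε hε
      obtain ⟨N, hN⟩ := Metric.cauchySeq_iff'.mp hyz.cauchySeq ε hε
      refine ⟨N, fun n hn => lt_of_le_of_lt ?_ (hN n hn)⟩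
      rw [dist_eq_norm, dist_eq_norm, ← hx', ← hx', ← LinearPMap.map_sub]
      exact norm_le_norm_apply hA (x n - x N)
    obtain ⟨w, hw⟩ := cauchySeq_tendsto_of_complete hc
    have hg : (w, z) ∈ A.graph := by
      have hcl : IsClosed (A.graph : Set (H × H)) := hA.isSelfAdjoint.isClosed
      refine hcl.mem_of_tendsto (hw.prodMk_nhds hyz) (Filter.Eventually.of_forall fun n => ?_)
      change ((x n : H), y n) ∈ A.graph
      rw [← hx']
      exact A.mem_graph (x n)
    rw [LinearPMap.mem_graph_iff] at hg
    obtain ⟨v, _, hv⟩ := hg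
    exact ⟨v, hv⟩
  have horth : A.toFun.rangeᗮ = ⊥ := by
    rw [Submodule.eq_bot_iff]
    intro y hy
    have hy' : ∀ x : A.domain, ⟪y, A x⟫_ℂ = 0 := fun x =>
      (Submodule.mem_orthogonal' _ _).mp hy _ ⟨x, rfl⟩
    have hex : ∀ x : A.domain, ⟪(0 : H), (x : H)⟫_ℂ = ⟪y, A x⟫_ℂ := fun x => by
      rw [hy' x, inner_zero_left]
    have hmem : y ∈ A.adjoint.domain := LinearPMap.mem_adjoint_domain_of_exists y ⟨0, hex⟩
    have hval : A.adjoint ⟨y, hmem⟩ = 0 := LinearPMap.adjoint_apply_eq hdense ⟨y, hmem⟩ hex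
    have hg : (y, (0 : H)) ∈ A.adjoint.graph := by
      have := A.adjoint.mem_graph ⟨y, hmem⟩
      rwa [hval] at this
    rw [hadj, LinearPMap.mem_graph_iff] at hg
    obtain ⟨v, hv, hv0⟩ := hg
    have h := norm_le_norm_apply hA v
    simp only at hv hv0
    rw [hv0, norm_zero, hv] at h
    exact norm_le_zero_iff.mp h
  have : CompleteSpace A.toFun.range := hclosed.completeSpace_coe
  exact (Submodule.orthogonal_eq_bot_iff).mp horth

lemma toPMap_boundedInverse {A : H →ₗ.[ℂ] H} (hA : IsSelfAdjointGeOne A) :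
    (boundedInverse A : H →ₗ[ℂ] H).toPMap ⊤ = A.inverse := by
  have hex : ∃ B : H →L[ℂ] H, (B : H →ₗ[ℂ] H).toPMap ⊤ = A.inverse := by
    have hdom : A.inverse.domain = ⊤ := by rw [LinearPMap.inverse_domain, range_eq_top hA]
    have hk := ker_eq_bot hA
    let f : H →ₗ[ℂ] H := A.inverse.toFun ∘ₗ
      (LinearMap.codRestrict A.inverse.domain LinearMap.id (fun x => by rw [hdom]; trivial))
    have hf : ∀ x : A.domain, f (A x) = x := fun x =>
      LinearPMap.inverse_apply_eq hk (x := x) rfl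
    have hbd : ∀ y, ‖f y‖ ≤ 1 * ‖y‖ := by
      intro y
      obtain ⟨x, hx⟩ : y ∈ A.toFun.range := by rw [range_eq_top hA]; trivial
      have hx' : A x = y := hx
      rw [← hx', hf, one_mul]
      exact norm_le_norm_apply hA x
    refine ⟨f.mkContinuous 1 hbd, ?_⟩
    refine LinearPMap.ext (by rw [hdom]; rfl) ?_
    intro x h1 h2
    rfl
  unfold boundedInverse
  rw [dif_pos hex]
  exact hex.choose_spec

lemma boundedInverse_apply {A : H →ₗ.[ℂ] H} (hA : IsSelfAdjointGeOne A) (x : A.domain) :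
    boundedInverse A (A x) = x := by
  have h := LinearPMap.mem_inverse_graph (ker_eq_bot hA) x
  rw [← toPMap_boundedInverse hA, LinearPMap.mem_graph_iff] at h
  obtain ⟨y, hy, hy'⟩ := h
  simp only at hy hy'
  rw [← hy', ← hy]
  rfl

lemma boundedInverse_nonneg {A : H →ₗ.[ℂ] H} (hA : IsSelfAdjointGeOne A) :
    0 ≤ boundedInverse A := by
  rw [ContinuousLinearMap.nonneg_iff_isPositive, ContinuousLinearMap.isPositive_iff_complex]
  intro y
  obtain ⟨x, hx⟩ : y ∈ A.toFun.range := by rw [range_eq_top hA]; trivial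
  have hx' : A x = y := hx
  rw [← hx', boundedInverse_apply hA]
  have hadj : A.adjoint = A := hA.isSelfAdjoint
  have hfa : A.IsFormalAdjoint A := by
    have := LinearPMap.adjoint_isFormalAdjoint hA.isSelfAdjoint.dense_domain
    rwa [hadj] at this
  have hsym : ⟪(x : H), A x⟫_ℂ = (starRingEnd ℂ) ⟪(x : H), A x⟫_ℂ := by
    rw [inner_conj_symm]; exact (hfa x x).symm
  refine ⟨Complex.conj_eq_iff_re.mp hsym.symm, ?_⟩
  exact (sq_nonneg _).trans (hA.ge_one x)

lemma boundedInverse_injective {A : H →ₗ.[ℂ] H} (hA : IsSelfAdjointGeOne A) :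
    Function.Injective (boundedInverse A) := by
  rw [injective_iff_map_eq_zero]
  intro y hy
  obtain ⟨x, hx⟩ : y ∈ A.toFun.range := by rw [range_eq_top hA]; trivial
  have hx' : A x = y := hx
  rw [← hx', boundedInverse_apply hA] at hy
  have : x = 0 := Subtype.ext hy
  rw [← hx', this, LinearPMap.map_zero]

/-- Powers of a nonnegative bounded operator with nonnegative exponents add up. -/
lemma clm_rpow_add {B : H →L[ℂ] H} (hB : 0 ≤ B) {a b : ℝ} (ha : 0 ≤ a) (hb : 0 ≤ b) :
    (B ^ (a + b) : H →L[ℂ] H) = B ^ a * B ^ b := by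
  rcases ha.eq_or_lt with rfl | ha
  · rw [zero_add, CFC.rpow_zero B hB, one_mul]
  rcases hb.eq_or_lt with rfl | hb
  · rw [add_zero, CFC.rpow_zero B hB, mul_one]
  lift a to ℝ≥0 using ha.le
  lift b to ℝ≥0 using hb.le
  have ha' : 0 < a := by exact_mod_cast ha
  have hb' : 0 < b := by exact_mod_cast hb
  rw [← CFC.nnrpow_eq_rpow ha', ← CFC.nnrpow_eq_rpow hb', ← CFC.nnrpow_add ha' hb',
    CFC.nnrpow_eq_rpow (add_pos ha' hb')]
  push_cast
  rfl

lemma boundedInverse_rpow_injective {A : H →ₗ.[ℂ] H} (hA : IsSelfAdjointGeOne A) {a : ℝ}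
    (ha : 0 ≤ a) : Function.Injective (boundedInverse A ^ a : H →L[ℂ] H) := by
  have hB := boundedInverse_nonneg hA
  obtain ⟨n, hn⟩ := exists_nat_ge a
  have hinj : ∀ k : ℕ, Function.Injective (boundedInverse A ^ k : H →L[ℂ] H) := by
    intro k
    induction k with
    | zero => rw [pow_zero]; exact Function.injective_id
    | succ k ih => rw [pow_succ]; exact ih.comp (boundedInverse_injective hA)
  have h : (boundedInverse A ^ ((n : ℝ) - a) : H →L[ℂ] H) * boundedInverse A ^ a
      = boundedInverse A ^ n := by
    rw [← clm_rpow_add hB (sub_nonneg.mpr hn) ha, sub_add_cancel, CFC.rpow_natCast _ _ hB]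
  have h2 := hinj n
  rw [← h] at h2
  exact Function.Injective.of_comp h2

lemma rpow_ker_eq_bot_range_eq_top {A : H →ₗ.[ℂ] H} (hA : IsSelfAdjointGeOne A) {a : ℝ}
    (ha : 0 ≤ a) : (rpow A a).toFun.ker = ⊥ ∧ (rpow A a).toFun.range = ⊤ := by
  set B : H →L[ℂ] H := boundedInverse A ^ a with hB
  have hk : ((B : H →ₗ[ℂ] H).toPMap ⊤).toFun.ker = ⊥ := by
    rw [LinearMap.ker_eq_bot']
    intro x hx
    have hx' : B x = B 0 := by rw [map_zero]; exact hx
    exact Subtype.ext (boundedInverse_rpow_injective hA ha hx')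
  have hr : rpow A a = ((B : H →ₗ[ℂ] H).toPMap ⊤).inverse := by
    unfold rpow; rw [if_pos ha]
  rw [hr]
  refine ⟨?_, LinearPMap.inverse_range hk⟩
  rw [LinearMap.ker_eq_bot']
  intro y hy
  obtain ⟨x, hx⟩ : (y : H) ∈ ((B : H →ₗ[ℂ] H).toPMap ⊤).toFun.range := by
    rw [← LinearPMap.inverse_domain]; exact y.2
  have h1 := LinearPMap.inverse_apply_eq hk (y := y) (x := x) hx
  have h2 : (x : H) = 0 := by rw [← h1]; exact hy
  apply Subtype.ext
  rw [← hx, show x = 0 from Subtype.ext h2, map_zero]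
  rfl

/-- `A ^ (r / 2)` as a linear map on `V_r(A)`. -/
def halfPower (A : H →ₗ.[ℂ] H) (r : ℝ≥0) : V A r →ₗ[ℂ] H :=
  (rpow A ((r : ℝ) / 2)).toFun

lemma halfPower_injective {A : H →ₗ.[ℂ] H} (hA : IsSelfAdjointGeOne A) (r : ℝ≥0) :
    Function.Injective (halfPower A r) :=
  LinearMap.ker_eq_bot.mp (rpow_ker_eq_bot_range_eq_top hA (by positivity)).1

lemma halfPower_surjective {A : H →ₗ.[ℂ] H} (hA : IsSelfAdjointGeOne A) (r : ℝ≥0) :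
    Function.Surjective (halfPower A r) :=
  LinearMap.range_eq_top.mp (rpow_ker_eq_bot_range_eq_top hA (by positivity)).2

end Powers

section Spaces

variable {H : Type u} [NormedAddCommGroup H] [InnerProductSpace ℂ H] [CompleteSpace H]

/-- The Hilbert space `H_r(A)`: the vector space `V_r(A) = dom (A ^ (r / 2))` with the inner
product `(A ^ (r / 2) x, A ^ (r / 2) y)`. The hypothesis `hA` is recorded in the type so that the
instances below can be found. -/
@[nolint unusedArguments]
def HSpace (A : H →ₗ.[ℂ] H) (_hA : IsSelfAdjointGeOne A) (r : ℝ≥0) : Type u := V A r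

variable {A : H →ₗ.[ℂ] H} {hA : IsSelfAdjointGeOne A} {r : ℝ≥0}

instance : AddCommGroup (HSpace A hA r) := inferInstanceAs (AddCommGroup (V A r))

instance : Module ℂ (HSpace A hA r) := inferInstanceAs (Module ℂ (V A r))

/-- `A ^ (r / 2)` as a linear map on `H_r(A)`. -/
def HSpace.halfPower (A : H →ₗ.[ℂ] H) (hA : IsSelfAdjointGeOne A) (r : ℝ≥0) :
    HSpace A hA r →ₗ[ℂ] H :=
  LeftDefinite.halfPower A r

/-- The norm of `H_r(A)` is `‖A ^ (r / 2) x‖`. -/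
instance : NormedAddCommGroup (HSpace A hA r) :=
  NormedAddCommGroup.induced _ _ (HSpace.halfPower A hA r) (halfPower_injective hA r)

/-- The inner product of `H_r(A)` is `(A ^ (r / 2) x, A ^ (r / 2) y)`. -/
instance : InnerProductSpace ℂ (HSpace A hA r) where
  inner x y := ⟪HSpace.halfPower A hA r x, HSpace.halfPower A hA r y⟫_ℂ
  norm_smul_le c x := by
    change ‖HSpace.halfPower A hA r (c • x)‖ ≤ ‖c‖ * ‖HSpace.halfPower A hA r x‖
    rw [map_smul, norm_smul]
  norm_sq_eq_re_inner x := norm_sq_eq_re_inner (𝕜 := ℂ) (HSpace.halfPower A hA r x)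
  conj_inner_symm x y := inner_conj_symm _ _
  add_left x y z := by rw [map_add, inner_add_left]
  smul_left x y c := by rw [map_smul, inner_smul_left]

instance : CompleteSpace (HSpace A hA r) := by
  let e : HSpace A hA r ≃ₗᵢ[ℂ] H :=
    ⟨LinearEquiv.ofBijective (HSpace.halfPower A hA r)
      ⟨halfPower_injective hA r, halfPower_surjective hA r⟩, fun _ => rfl⟩
  exact e.toIsometryEquiv.completeSpace

/-- The inclusion of `H_r(A)` into `H`. -/
def HSpace.incl (A : H →ₗ.[ℂ] H) (hA : IsSelfAdjointGeOne A) (r : ℝ≥0) :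
    HSpace A hA r →ₗ[ℂ] H :=
  (V A r).subtype

lemma HSpace.incl_injective (A : H →ₗ.[ℂ] H) (hA : IsSelfAdjointGeOne A) (r : ℝ≥0) :
    Function.Injective (HSpace.incl A hA r) :=
  (V A r).injective_subtype

end Spaces

section Operators

/-- For an injective linear map `ι : E → F` and an operator `T` in `E`, the operator `ι T ι⁻¹`
in `F` with domain `ι (dom T)`. -/
def transport {E F : Type*} [AddCommGroup E] [Module ℂ E] [AddCommGroup F] [Module ℂ F]
    (ι : E →ₗ[ℂ] F) (hι : Function.Injective ι) (T : E →ₗ.[ℂ] E) : F →ₗ.[ℂ] F where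
  domain := T.domain.map ι
  toFun := ι ∘ₗ T.toFun ∘ₗ ((Submodule.equivMapOfInjective ι hι T.domain).symm : _ →ₗ[ℂ] T.domain)

/-- The operator `U T U⁻¹` in `F` with domain `U (dom T)`, for a unitary map `U : E → F` and an
operator `T` in `E`. -/
def conj {E F : Type*} [NormedAddCommGroup E] [InnerProductSpace ℂ E] [NormedAddCommGroup F]
    [InnerProductSpace ℂ F] (U : E ≃ₗᵢ[ℂ] F) (T : E →ₗ.[ℂ] E) : F →ₗ.[ℂ] F :=
  transport (U.toLinearEquiv : E →ₗ[ℂ] F) U.injective T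

/-- `Φ` assigns to every operator `T` in a complex Hilbert space an element `Φ T` of `α`, and takes
the same value on unitarily equivalent operators. -/
def IsUnitaryInvariant {α : Type*}
    (Φ : ∀ (K : Type u) [NormedAddCommGroup K] [InnerProductSpace ℂ K] [CompleteSpace K],
      (K →ₗ.[ℂ] K) → α) : Prop :=
  ∀ (K L : Type u) [NormedAddCommGroup K] [InnerProductSpace ℂ K] [CompleteSpace K]
    [NormedAddCommGroup L] [InnerProductSpace ℂ L] [CompleteSpace L]
    (U : K ≃ₗᵢ[ℂ] L) (T : K →ₗ.[ℂ] K), Φ L (conj U T) = Φ K T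

variable {H : Type u} [NormedAddCommGroup H] [InnerProductSpace ℂ H] [CompleteSpace H]
  {A : H →ₗ.[ℂ] H} {hA : IsSelfAdjointGeOne A}

/-- An operator `T` in `H_r(A)`, regarded as an operator acting in `H`, with the same domain. -/
def inH {r : ℝ≥0} (T : HSpace A hA r →ₗ.[ℂ] HSpace A hA r) : H →ₗ.[ℂ] H :=
  transport (HSpace.incl A hA r) (HSpace.incl_injective A hA r) T

/-- The map `U : H_p(A) → H_q(A)` is `u ↦ A ^ a u`; in particular `H_p(A) ⊆ dom (A ^ a)`. -/
def IsPowerMap {p q : ℝ≥0} (a : ℝ) (U : HSpace A hA p → HSpace A hA q) : Prop :=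
  ∀ u : HSpace A hA p, ∃ h : HSpace.incl A hA p u ∈ (rpow A a).domain,
    HSpace.incl A hA q (U u) = rpow A a ⟨HSpace.incl A hA p u, h⟩

end Operators

end LeftDefinite

end

open LeftDefinite

/-!
# Left-definite operators of a self-adjoint operator `A ≥ I`

Everything is expressed through the bounded injective operators `P a = (A⁻¹) ^ a`, `a ≥ 0`, which
satisfy `P (a + b) = P a P b`. The graph of `A ^ a` consists of the pairs `(P a y, y)` if `a ≥ 0`
and `(x, P (-a) x)` if `a ≤ 0`, so `A ^ (a - b)` maps `P a h` to `P b h` for all `a, b ≥ 0`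
(`rpow_sub_mem_graph`).

The space `H_r(A)` is the range of `P (r / 2)`, normed so that `P (r / 2) : H → H_r(A)` is unitary
(`HSpace.ofBase`). The operator `A_r` is the image of `A` under this unitary map. It is therefore
self-adjoint, and all `A_r` are unitarily equivalent, the maps `A ^ ((r - s) / 2)` being the
compositions `H_r(A) → H → H_s(A)`. As `P (r / 2)` commutes with `A⁻¹`, the operator `A_r` is the
largest restriction of `A` with domain and range in `H_r(A)` (`mem_leftDefiniteOp_graph`), and its
domain is the range of `P (r / 2) A⁻¹ = P ((r + 2) / 2)`. Any self-adjoint restriction of `A` in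
`H_r(A)` is contained in it, and self-adjoint operators have no proper self-adjoint extensions;
this gives uniqueness.

Finally, `A` is bounded if and only if `A⁻¹` is onto, which holds if and only if one (equivalently,
every) `P a` with `a > 0` is onto. This decides between strictness of the inclusions `V_strictAnti`
and equivalence of the norms `norm_HSpace_equiv`.
-/

noncomputable section

namespace LeftDefinite

/-! ### Self-adjoint operators through their graphs -/

section Graphs

variable {E F : Type*} [NormedAddCommGroup E] [InnerProductSpace ℂ E]
  [NormedAddCommGroup F] [InnerProductSpace ℂ F]

lemma eq_of_mem_graph_iff {S T : E →ₗ.[ℂ] F}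
    (h : ∀ x y, (x, y) ∈ S.graph ↔ (x, y) ∈ T.graph) : S = T :=
  LinearPMap.eq_of_eq_graph (Submodule.ext fun p => h p.1 p.2)

lemma isSelfAdjoint_iff_mem_graph [CompleteSpace E] {T : E →ₗ.[ℂ] E}
    (hT : Dense (T.domain : Set E)) :
    IsSelfAdjoint T ↔ ∀ x y, (x, y) ∈ T.graph ↔
      ∀ a b, (a, b) ∈ T.graph → ⟪b, x⟫_ℂ = ⟪a, y⟫_ℂ := by
  have hadj : ∀ x y, (x, y) ∈ T.adjoint.graph ↔
      ∀ a b, (a, b) ∈ T.graph → ⟪b, x⟫_ℂ = ⟪a, y⟫_ℂ := fun x y => by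
    simp only [LinearPMap.adjoint_graph_eq_graph_adjoint hT, Submodule.mem_adjoint_iff,
      sub_eq_zero]
  rw [LinearPMap.isSelfAdjoint_def]
  constructor
  · intro h x y
    rw [← hadj, h]
  · intro h
    exact eq_of_mem_graph_iff fun x y => by rw [hadj, h]

/-- Self-adjoint operators are maximal: none properly extends another. -/
lemma eq_of_le_of_isSelfAdjoint [CompleteSpace E] {S T : E →ₗ.[ℂ] E} (hS : IsSelfAdjoint S)
    (hT : IsSelfAdjoint T) (h : S ≤ T) : S = T := by
  have hle := LinearPMap.le_graph_of_le h
  refine eq_of_mem_graph_iff fun x y => ⟨fun hxy => hle hxy, fun hxy => ?_⟩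
  rw [(isSelfAdjoint_iff_mem_graph hS.dense_domain).mp hS]
  exact fun a b hab =>
    ((isSelfAdjoint_iff_mem_graph hT.dense_domain).mp hT x y).mp hxy a b (hle hab)

lemma mem_transport_graph {E F : Type*} [AddCommGroup E] [Module ℂ E] [AddCommGroup F]
    [Module ℂ F] (ι : E →ₗ[ℂ] F) (hι : Function.Injective ι) (T : E →ₗ.[ℂ] E) {x y : F} :
    (x, y) ∈ (transport ι hι T).graph ↔ ∃ a b, (a, b) ∈ T.graph ∧ ι a = x ∧ ι b = y := by
  have happ : ∀ (a : T.domain) (h : ι a ∈ (transport ι hι T).domain),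
      transport ι hι T ⟨ι a, h⟩ = ι (T a) := fun a h => by
    change ι (T.toFun ((Submodule.equivMapOfInjective ι hι T.domain).symm ⟨ι a, h⟩)) = ι (T a)
    have : (⟨ι a, h⟩ : T.domain.map ι) = Submodule.equivMapOfInjective ι hι T.domain a := rfl
    rw [this, LinearEquiv.symm_apply_apply]
    rfl
  constructor
  · rw [LinearPMap.mem_graph_iff]
    rintro ⟨⟨_, a, ha, rfl⟩, rfl, rfl⟩
    exact ⟨a, T ⟨a, ha⟩, T.mem_graph ⟨a, ha⟩, rfl, (happ ⟨a, ha⟩ _).symm⟩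
  · rintro ⟨a, b, hab, rfl, rfl⟩
    rw [LinearPMap.mem_graph_iff] at hab
    obtain ⟨a, rfl, rfl⟩ := hab
    rw [LinearPMap.mem_graph_iff]
    exact ⟨⟨ι a, a, a.2, rfl⟩, rfl, happ a _⟩

lemma mem_conj_graph (U : E ≃ₗᵢ[ℂ] F) (T : E →ₗ.[ℂ] E) {x y : F} :
    (x, y) ∈ (conj U T).graph ↔ (U.symm x, U.symm y) ∈ T.graph := by
  unfold conj
  rw [mem_transport_graph]
  constructor
  · rintro ⟨a, b, hab, rfl, rfl⟩
    have h1 : U.symm (U.toLinearEquiv a) = a := U.symm_apply_apply a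
    have h2 : U.symm (U.toLinearEquiv b) = b := U.symm_apply_apply b
    simpa only [LinearEquiv.coe_coe, h1, h2] using hab
  · exact fun h => ⟨_, _, h, U.apply_symm_apply x, U.apply_symm_apply y⟩

lemma conj_symm_conj (U : E ≃ₗᵢ[ℂ] F) (T : E →ₗ.[ℂ] E) : conj U.symm (conj U T) = T :=
  eq_of_mem_graph_iff fun x y => by
    rw [mem_conj_graph, mem_conj_graph, LinearIsometryEquiv.symm_symm, U.symm_apply_apply,
      U.symm_apply_apply]

lemma isSelfAdjoint_conj [CompleteSpace E] [CompleteSpace F] (U : E ≃ₗᵢ[ℂ] F) {T : E →ₗ.[ℂ] E}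
    (hT : IsSelfAdjoint T) : IsSelfAdjoint (conj U T) := by
  have hd : Dense ((conj U T).domain : Set F) := by
    have h : ((conj U T).domain : Set F) = U '' (T.domain : Set E) := rfl
    rw [h]
    exact U.surjective.denseRange.dense_image U.continuous hT.dense_domain
  rw [isSelfAdjoint_iff_mem_graph hd]
  intro x y
  rw [mem_conj_graph, (isSelfAdjoint_iff_mem_graph hT.dense_domain).mp hT]
  have hinner : ∀ (a : E) (x : F), ⟪a, U.symm x⟫_ℂ = ⟪U a, x⟫_ℂ := fun a x => by
    rw [← U.inner_map_map, U.apply_symm_apply]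
  simp only [mem_conj_graph, hinner]
  constructor
  · intro h a b hab
    simpa using h _ _ hab
  · intro h a b hab
    exact h _ _ (by simpa using hab)

lemma mem_toPMap_top_graph (B : E →ₗ[ℂ] F) {x : E} {y : F} :
    (x, y) ∈ (B.toPMap ⊤).graph ↔ B x = y := by
  rw [LinearPMap.mem_graph_iff]
  exact ⟨fun ⟨a, ha, hb⟩ => by simp only at ha hb; rw [← ha, ← hb]; rfl,
    fun h => ⟨⟨x, trivial⟩, rfl, h⟩⟩

lemma mem_inverse_graph_iff {f : E →ₗ.[ℂ] F} (hf : f.toFun.ker = ⊥) {x : F} {y : E} :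
    (x, y) ∈ f.inverse.graph ↔ (y, x) ∈ f.graph := by
  rw [LinearPMap.inverse_graph hf, Submodule.mem_map]
  constructor
  · rintro ⟨⟨a, b⟩, hab, h⟩
    obtain ⟨rfl, rfl⟩ := Prod.mk.inj h
    exact hab
  · exact fun h => ⟨(y, x), h, rfl⟩

end Graphs

/-! ### Graphs of the real powers -/

section PowerGraphs

variable {H : Type u} [NormedAddCommGroup H] [InnerProductSpace ℂ H] [CompleteSpace H]
  {A : H →ₗ.[ℂ] H}

lemma mem_graph_iff_boundedInverse (hA : IsSelfAdjointGeOne A) {x y : H} :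
    (x, y) ∈ A.graph ↔ boundedInverse A y = x := by
  rw [← mem_inverse_graph_iff (ker_eq_bot hA), ← toPMap_boundedInverse hA, mem_toPMap_top_graph]
  rfl

lemma mem_rpow_graph_of_nonneg (hA : IsSelfAdjointGeOne A) {a : ℝ} (ha : 0 ≤ a) {x y : H} :
    (x, y) ∈ (rpow A a).graph ↔ (boundedInverse A ^ a : H →L[ℂ] H) y = x := by
  unfold rpow
  rw [if_pos ha, mem_inverse_graph_iff, mem_toPMap_top_graph]
  · rfl
  · rw [LinearMap.ker_eq_bot']
    intro x hx
    exact Subtype.ext (boundedInverse_rpow_injective hA ha (hx.trans (map_zero _).symm))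

lemma mem_rpow_graph_of_nonpos (hA : IsSelfAdjointGeOne A) {a : ℝ} (ha : a ≤ 0) {x y : H} :
    (x, y) ∈ (rpow A a).graph ↔ (boundedInverse A ^ (-a) : H →L[ℂ] H) x = y := by
  rcases ha.eq_or_lt with rfl | ha
  · rw [mem_rpow_graph_of_nonneg hA le_rfl, neg_zero,
      CFC.rpow_zero _ (boundedInverse_nonneg hA)]
    exact eq_comm
  · unfold rpow
    rw [if_neg ha.not_ge, mem_toPMap_top_graph]
    rfl

lemma boundedInverse_rpow_add_apply (hA : IsSelfAdjointGeOne A) {a b : ℝ} (ha : 0 ≤ a)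
    (hb : 0 ≤ b) (x : H) : (boundedInverse A ^ (a + b) : H →L[ℂ] H) x =
      (boundedInverse A ^ a : H →L[ℂ] H) ((boundedInverse A ^ b : H →L[ℂ] H) x) := by
  rw [clm_rpow_add (boundedInverse_nonneg hA) ha hb]
  rfl

/-- `A ^ c` maps `A ^ (-a) h` to `A ^ (-b) h` whenever `a, b ≥ 0` and `c = a - b`. -/
lemma rpow_sub_mem_graph (hA : IsSelfAdjointGeOne A) {a b c : ℝ} (ha : 0 ≤ a) (hb : 0 ≤ b)
    (hc : c = a - b) (h : H) : ((boundedInverse A ^ a : H →L[ℂ] H) h,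
      (boundedInverse A ^ b : H →L[ℂ] H) h) ∈ (rpow A c).graph := by
  rcases le_total 0 c with h0 | h0
  · rw [mem_rpow_graph_of_nonneg hA h0, ← boundedInverse_rpow_add_apply hA h0 hb, hc,
      sub_add_cancel]
  · rw [mem_rpow_graph_of_nonpos hA h0,
      ← boundedInverse_rpow_add_apply hA (neg_nonneg.mpr h0) ha, hc, neg_sub, sub_add_cancel]

lemma boundedInverse_rpow_one (hA : IsSelfAdjointGeOne A) :
    (boundedInverse A ^ (1 : ℝ) : H →L[ℂ] H) = boundedInverse A :=
  CFC.rpow_one _ (boundedInverse_nonneg hA)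

lemma boundedInverse_rpow_comm_apply (hA : IsSelfAdjointGeOne A) {a : ℝ} (ha : 0 ≤ a) (h : H) :
    (boundedInverse A ^ a : H →L[ℂ] H) (boundedInverse A h) =
      boundedInverse A ((boundedInverse A ^ a : H →L[ℂ] H) h) := by
  have h1 := boundedInverse_rpow_add_apply hA ha zero_le_one h
  have h2 := boundedInverse_rpow_add_apply hA zero_le_one ha h
  rw [boundedInverse_rpow_one hA] at h1 h2
  rw [← h1, add_comm, h2]

lemma mem_V_iff (hA : IsSelfAdjointGeOne A) {r : ℝ≥0} {x : H} :
    x ∈ V A r ↔ ∃ h, (boundedInverse A ^ ((r : ℝ) / 2) : H →L[ℂ] H) h = x := by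
  unfold V
  rw [LinearPMap.mem_domain_iff]
  simp only [mem_rpow_graph_of_nonneg hA (show (0 : ℝ) ≤ (r : ℝ) / 2 by positivity)]

lemma V_antitone (hA : IsSelfAdjointGeOne A) : Antitone (V A) := by
  intro r s hrs x hx
  rw [mem_V_iff hA] at hx ⊢
  obtain ⟨h, rfl⟩ := hx
  have h0 : (0 : ℝ) ≤ ((s : ℝ) - r) / 2 := by
    have : (r : ℝ) ≤ s := hrs
    linarith
  refine ⟨(boundedInverse A ^ (((s : ℝ) - r) / 2) : H →L[ℂ] H) h, ?_⟩
  rw [← boundedInverse_rpow_add_apply hA (by positivity) h0]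
  ring_nf

lemma V_zero (hA : IsSelfAdjointGeOne A) : V A 0 = ⊤ := by
  rw [eq_top_iff]
  intro x _
  rw [mem_V_iff hA]
  refine ⟨x, ?_⟩
  rw [NNReal.coe_zero, zero_div, CFC.rpow_zero _ (boundedInverse_nonneg hA)]
  rfl

lemma V_two (hA : IsSelfAdjointGeOne A) : V A 2 = A.domain := by
  ext x
  rw [mem_V_iff hA, LinearPMap.mem_domain_iff, NNReal.coe_ofNat, div_self two_ne_zero,
    boundedInverse_rpow_one hA]
  simp only [mem_graph_iff_boundedInverse hA]

lemma mem_V_add_two_iff (hA : IsSelfAdjointGeOne A) {r : ℝ≥0} {x : H} :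
    x ∈ V A (r + 2) ↔
      ∃ h, (boundedInverse A ^ ((r : ℝ) / 2) : H →L[ℂ] H) (boundedInverse A h) = x := by
  rw [mem_V_iff hA]
  have : ((r + 2 : ℝ≥0) : ℝ) / 2 = (r : ℝ) / 2 + 1 := by push_cast; ring
  simp only [this, boundedInverse_rpow_add_apply hA (show (0 : ℝ) ≤ (r : ℝ) / 2 by positivity)
    zero_le_one, boundedInverse_rpow_one hA]

/-! ### Boundedness of `A` and surjectivity of the powers of `A⁻¹` -/

lemma isBoundedOp_iff_surjective (hA : IsSelfAdjointGeOne A) :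
    IsBoundedOp A ↔ Function.Surjective (boundedInverse A) := by
  constructor
  · rintro ⟨C, hC⟩
    have hanti : AntilipschitzWith C.toNNReal (boundedInverse A) := by
      refine AddMonoidHomClass.antilipschitz_of_bound _ fun y => ?_
      obtain ⟨x, hx⟩ : y ∈ A.toFun.range := by rw [range_eq_top hA]; trivial
      have hx' : A x = y := hx
      rw [← hx', boundedInverse_apply hA]
      exact (hC x).trans (mul_le_mul_of_nonneg_right (Real.le_coe_toNNReal C) (norm_nonneg _))
    have hcl : IsClosed (Set.range (boundedInverse A)) :=
      hanti.isClosed_range (boundedInverse A).uniformContinuous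
    have hran : Set.range (boundedInverse A) = A.domain := by
      ext x
      rw [SetLike.mem_coe, LinearPMap.mem_domain_iff]
      simp only [mem_graph_iff_boundedInverse hA, Set.mem_range]
    rw [← Set.range_eq_univ, ← hcl.closure_eq, hran]
    exact hA.isSelfAdjoint.dense_domain.closure_eq
  · intro hs
    let e := ContinuousLinearEquiv.ofBijective (boundedInverse A)
      (LinearMap.ker_eq_bot.mpr (boundedInverse_injective hA)) (LinearMap.range_eq_top.mpr hs)
    refine ⟨‖(e.symm : H →L[ℂ] H)‖, fun x => ?_⟩
    have h : e.symm (x : H) = A x := by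
      rw [ContinuousLinearEquiv.symm_apply_eq]
      exact (boundedInverse_apply hA x).symm
    rw [← h]
    exact (e.symm : H →L[ℂ] H).le_opNorm _

lemma boundedInverse_rpow_surjective (hA : IsSelfAdjointGeOne A) (hb : IsBoundedOp A) {a : ℝ}
    (ha : 0 ≤ a) : Function.Surjective (boundedInverse A ^ a : H →L[ℂ] H) := by
  obtain ⟨n, hn⟩ := exists_nat_ge a
  have hs := (isBoundedOp_iff_surjective hA).mp hb
  have hpow : ∀ k : ℕ, Function.Surjective (boundedInverse A ^ k : H →L[ℂ] H) := by
    intro k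
    induction k with
    | zero => rw [pow_zero]; exact Function.surjective_id
    | succ k ih => rw [pow_succ]; exact ih.comp hs
  intro y
  obtain ⟨x, hx⟩ := hpow n y
  refine ⟨(boundedInverse A ^ ((n : ℝ) - a) : H →L[ℂ] H) x, ?_⟩
  rw [← boundedInverse_rpow_add_apply hA ha (sub_nonneg.mpr hn), add_sub_cancel,
    CFC.rpow_natCast _ _ (boundedInverse_nonneg hA), hx]

lemma isBoundedOp_of_rpow_surjective (hA : IsSelfAdjointGeOne A) {a : ℝ} (ha : 0 < a)
    (hs : Function.Surjective (boundedInverse A ^ a : H →L[ℂ] H)) : IsBoundedOp A := by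
  rw [isBoundedOp_iff_surjective hA]
  obtain ⟨n, hn⟩ := exists_nat_ge (1 / a)
  have hn' : 1 ≤ n * a := by rwa [div_le_iff₀ ha] at hn
  have hmul : ∀ k : ℕ, Function.Surjective (boundedInverse A ^ ((k : ℝ) * a) : H →L[ℂ] H) := by
    intro k
    induction k with
    | zero =>
      rw [Nat.cast_zero, zero_mul, CFC.rpow_zero _ (boundedInverse_nonneg hA)]
      exact Function.surjective_id
    | succ k ih =>
      rw [Nat.cast_succ, add_mul, one_mul,
        clm_rpow_add (boundedInverse_nonneg hA) (by positivity) ha.le]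
      exact ih.comp hs
  intro y
  obtain ⟨x, hx⟩ := hmul n y
  refine ⟨(boundedInverse A ^ ((n : ℝ) * a - 1) : H →L[ℂ] H) x, ?_⟩
  rw [← hx, ← add_sub_cancel 1 ((n : ℝ) * a), boundedInverse_rpow_add_apply hA zero_le_one
    (sub_nonneg.mpr hn'), boundedInverse_rpow_one hA, add_sub_cancel]

lemma V_eq_top (hA : IsSelfAdjointGeOne A) (hb : IsBoundedOp A) (r : ℝ≥0) : V A r = ⊤ := by
  rw [eq_top_iff]
  intro x _
  rw [mem_V_iff hA]
  exact boundedInverse_rpow_surjective hA hb (by positivity) x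

/-- If `V_r(A) = V_s(A)` for some `r < s`, then `A ^ (-(s - r) / 2)` is onto by injectivity of
`A ^ (-r / 2)`, hence so are its integer powers, and `A` is bounded. -/
lemma V_strictAnti (hA : IsSelfAdjointGeOne A) (hb : ¬ IsBoundedOp A) : StrictAnti (V A) := by
  intro r s hrs
  refine lt_of_le_not_ge (V_antitone hA hrs.le) fun hle => hb ?_
  have h0 : (0 : ℝ) < ((s : ℝ) - r) / 2 := by
    have : (r : ℝ) < s := hrs
    linarith
  refine isBoundedOp_of_rpow_surjective hA h0 fun y => ?_
  obtain ⟨h, hh⟩ := (mem_V_iff hA).mp (hle ((mem_V_iff hA).mpr ⟨y, rfl⟩))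
  refine ⟨h, boundedInverse_rpow_injective hA (a := (r : ℝ) / 2) (by positivity) ?_⟩
  rw [← hh, ← boundedInverse_rpow_add_apply hA (by positivity) h0.le]
  ring_nf

end PowerGraphs

/-! ### The scale of spaces and the operators `A_r` -/

section Scale

variable {H : Type u} [NormedAddCommGroup H] [InnerProductSpace ℂ H] [CompleteSpace H]
  (A : H →ₗ.[ℂ] H) (hA : IsSelfAdjointGeOne A)

/-- The unitary map `A ^ (-r / 2) : H → H_r(A)`, the inverse of `A ^ (r / 2) : H_r(A) → H`. -/
def HSpace.ofBase (r : ℝ≥0) : H ≃ₗᵢ[ℂ] HSpace A hA r :=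
  LinearIsometryEquiv.symm
    ⟨LinearEquiv.ofBijective (HSpace.halfPower A hA r)
      ⟨halfPower_injective hA r, halfPower_surjective hA r⟩, fun _ => rfl⟩

/-- The operator `A_r`, obtained by transferring `A` from `H` to `H_r(A)` along the unitary map
`A ^ (-r / 2)`. -/
def leftDefiniteOp (r : ℝ≥0) : HSpace A hA r →ₗ.[ℂ] HSpace A hA r :=
  conj (HSpace.ofBase A hA r) A

variable {A} {hA}

lemma incl_eq_rpow_ofBase_symm {r : ℝ≥0} (u : HSpace A hA r) :
    HSpace.incl A hA r u =
      (boundedInverse A ^ ((r : ℝ) / 2) : H →L[ℂ] H) ((HSpace.ofBase A hA r).symm u) := by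
  have h : (HSpace.incl A hA r u, (HSpace.ofBase A hA r).symm u) ∈
      (rpow A ((r : ℝ) / 2)).graph := (rpow A ((r : ℝ) / 2)).mem_graph u
  exact ((mem_rpow_graph_of_nonneg hA (by positivity)).mp h).symm

lemma incl_ofBase {r : ℝ≥0} (h : H) : HSpace.incl A hA r (HSpace.ofBase A hA r h) =
    (boundedInverse A ^ ((r : ℝ) / 2) : H →L[ℂ] H) h := by
  rw [incl_eq_rpow_ofBase_symm, LinearIsometryEquiv.symm_apply_apply]

lemma mem_leftDefiniteOp_graph {r : ℝ≥0} {u w : HSpace A hA r} :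
    (u, w) ∈ (leftDefiniteOp A hA r).graph ↔
      (HSpace.incl A hA r u, HSpace.incl A hA r w) ∈ A.graph := by
  unfold leftDefiniteOp
  rw [mem_conj_graph, mem_graph_iff_boundedInverse hA, mem_graph_iff_boundedInverse hA,
    incl_eq_rpow_ofBase_symm u, incl_eq_rpow_ofBase_symm w,
    ← boundedInverse_rpow_comm_apply hA (by positivity)]
  exact (boundedInverse_rpow_injective hA (by positivity)).eq_iff.symm

lemma mem_inH_graph {r : ℝ≥0} {T : HSpace A hA r →ₗ.[ℂ] HSpace A hA r} {x y : H} :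
    (x, y) ∈ (inH T).graph ↔
      ∃ u w, (u, w) ∈ T.graph ∧ HSpace.incl A hA r u = x ∧ HSpace.incl A hA r w = y :=
  mem_transport_graph _ _ _

lemma isSelfAdjoint_leftDefiniteOp (r : ℝ≥0) : IsSelfAdjoint (leftDefiniteOp A hA r) :=
  isSelfAdjoint_conj _ hA.isSelfAdjoint

lemma inH_leftDefiniteOp_le (r : ℝ≥0) : inH (leftDefiniteOp A hA r) ≤ A := by
  refine LinearPMap.le_of_le_graph fun ⟨x, y⟩ h => ?_
  obtain ⟨u, w, huw, rfl, rfl⟩ := mem_inH_graph.mp h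
  exact mem_leftDefiniteOp_graph.mp huw

lemma inH_leftDefiniteOp_domain (r : ℝ≥0) :
    (inH (leftDefiniteOp A hA r)).domain = V A (r + 2) := by
  ext x
  rw [mem_V_add_two_iff hA, LinearPMap.mem_domain_iff]
  constructor
  · rintro ⟨y, h⟩
    obtain ⟨u, w, huw, rfl, rfl⟩ := mem_inH_graph.mp h
    rw [mem_leftDefiniteOp_graph, mem_graph_iff_boundedInverse hA] at huw
    refine ⟨(HSpace.ofBase A hA r).symm w, ?_⟩
    rw [boundedInverse_rpow_comm_apply hA (by positivity), ← incl_eq_rpow_ofBase_symm, huw]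
  · rintro ⟨h, rfl⟩
    refine ⟨_, mem_inH_graph.mpr ⟨HSpace.ofBase A hA r (boundedInverse A h),
      HSpace.ofBase A hA r h, ?_, incl_ofBase _, rfl⟩⟩
    rw [mem_leftDefiniteOp_graph, mem_graph_iff_boundedInverse hA, incl_ofBase, incl_ofBase,
      boundedInverse_rpow_comm_apply hA (by positivity)]

lemma V_add_two_le_domain (hA : IsSelfAdjointGeOne A) (r : ℝ≥0) : V A (r + 2) ≤ A.domain := by
  rw [← V_two hA]
  exact V_antitone hA le_add_self

lemma inH_leftDefiniteOp (r : ℝ≥0) :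
    inH (leftDefiniteOp A hA r) = A.domRestrict (V A (r + 2)) := by
  refine LinearPMap.ext ?_ fun x h1 h2 => ?_
  · rw [inH_leftDefiniteOp_domain, LinearPMap.domRestrict_domain,
      inf_eq_left.mpr (V_add_two_le_domain hA r)]
  · have hx : x ∈ A.domain := (inH_leftDefiniteOp_le r).1 h1
    exact ((inH_leftDefiniteOp_le r).2 (x := ⟨x, h1⟩) (y := ⟨x, hx⟩) rfl).trans
      (LinearPMap.domRestrict_apply (x := ⟨x, h2⟩) (y := ⟨x, hx⟩) rfl).symm

/-- A self-adjoint operator in `H_r(A)` that restricts `A` is contained in `A_r`, since `A_r` is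
the largest restriction of `A` acting in `H_r(A)`; by maximality they agree. -/
lemma eq_leftDefiniteOp {r : ℝ≥0} {T : HSpace A hA r →ₗ.[ℂ] HSpace A hA r}
    (hT : IsSelfAdjoint T) (hle : inH T ≤ A) : T = leftDefiniteOp A hA r := by
  refine eq_of_le_of_isSelfAdjoint hT (isSelfAdjoint_leftDefiniteOp r)
    (LinearPMap.le_of_le_graph fun ⟨u, w⟩ h => ?_)
  exact mem_leftDefiniteOp_graph.mpr
    (LinearPMap.le_graph_of_le hle (mem_inH_graph.mpr ⟨u, w, h, rfl, rfl⟩))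

lemma inH_leftDefiniteOp_eq_of_V_eq {r : ℝ≥0} (h : V A (r + 2) = A.domain) :
    inH (leftDefiniteOp A hA r) = A :=
  LinearPMap.eq_of_le_of_domain_eq (inH_leftDefiniteOp_le r)
    ((inH_leftDefiniteOp_domain r).trans h)

lemma inner_HSpace_zero (x y : HSpace A hA 0) :
    ⟪x, y⟫_ℂ = ⟪HSpace.incl A hA 0 x, HSpace.incl A hA 0 y⟫_ℂ := by
  have h : ∀ u : HSpace A hA 0, HSpace.incl A hA 0 u = (HSpace.ofBase A hA 0).symm u := by
    intro u
    rw [incl_eq_rpow_ofBase_symm, NNReal.coe_zero, zero_div,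
      CFC.rpow_zero _ (boundedInverse_nonneg hA)]
    rfl
  rw [h, h, LinearIsometryEquiv.inner_map_map]

/-- For bounded `A`, the norm of `H_r(A)` is equivalent to that of `H`, because `A ^ (-r / 2)` is a
bounded bijection of `H`. -/
lemma norm_HSpace_equiv (hb : IsBoundedOp A) (r : ℝ≥0) :
    ∃ c C : ℝ, 0 < c ∧ 0 < C ∧ ∀ u : HSpace A hA r,
      c * ‖HSpace.incl A hA r u‖ ≤ ‖u‖ ∧ ‖u‖ ≤ C * ‖HSpace.incl A hA r u‖ := by
  have hr : (0 : ℝ) ≤ (r : ℝ) / 2 := by positivity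
  set P : H →L[ℂ] H := boundedInverse A ^ ((r : ℝ) / 2) with hP
  let e := ContinuousLinearEquiv.ofBijective P
    (LinearMap.ker_eq_bot.mpr (boundedInverse_rpow_injective hA hr))
    (LinearMap.range_eq_top.mpr (boundedInverse_rpow_surjective hA hb hr))
  -- adding `1` keeps the constants positive when `H` is trivial
  have h1 : 0 < ‖P‖ + 1 := by positivity
  have h2 : 0 < ‖(e.symm : H →L[ℂ] H)‖ + 1 := by positivity
  refine ⟨(‖P‖ + 1)⁻¹, ‖(e.symm : H →L[ℂ] H)‖ + 1, inv_pos.mpr h1, h2, fun u => ?_⟩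
  set h : H := (HSpace.ofBase A hA r).symm u with hh
  have hu : ‖u‖ = ‖h‖ := ((HSpace.ofBase A hA r).symm.norm_map u).symm
  have hPu : HSpace.incl A hA r u = P h := incl_eq_rpow_ofBase_symm u
  rw [hu, hPu]
  constructor
  · rw [inv_mul_le_iff₀ h1]
    exact (P.le_opNorm h).trans (by gcongr; linarith)
  · have he : e.symm (P h) = h := e.symm_apply_apply h
    calc ‖h‖ = ‖(e.symm : H →L[ℂ] H) (P h)‖ := by rw [ContinuousLinearEquiv.coe_coe, he]
      _ ≤ ‖(e.symm : H →L[ℂ] H)‖ * ‖P h‖ := ContinuousLinearMap.le_opNorm _ _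
      _ ≤ _ := by gcongr; linarith

variable (A) (hA)

/-- The unitary map `A ^ ((p - q) / 2) : H_p(A) → H_q(A)`, factored through `H`. -/
def HSpace.shift (p q : ℝ≥0) : HSpace A hA p ≃ₗᵢ[ℂ] HSpace A hA q :=
  (HSpace.ofBase A hA p).symm.trans (HSpace.ofBase A hA q)

variable {A} {hA}

lemma isPowerMap_shift {p q : ℝ≥0} {a : ℝ} (ha : a = ((p : ℝ) - q) / 2) :
    IsPowerMap a (HSpace.shift A hA p q) := by
  intro u
  have hg := rpow_sub_mem_graph hA (a := (p : ℝ) / 2) (b := (q : ℝ) / 2) (c := a)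
    (by positivity) (by positivity) (by rw [ha, sub_div]) ((HSpace.ofBase A hA p).symm u)
  rw [← incl_eq_rpow_ofBase_symm, ← incl_ofBase (hA := hA)] at hg
  have hd := LinearPMap.mem_domain_of_mem_graph hg
  exact ⟨hd, LinearPMap.mem_graph_snd_inj _ hg ((rpow A a).mem_graph ⟨_, hd⟩) rfl⟩

lemma conj_shift (p q : ℝ≥0) :
    conj (HSpace.shift A hA p q) (leftDefiniteOp A hA p) = leftDefiniteOp A hA q :=
  eq_of_mem_graph_iff fun x y => by
    unfold leftDefiniteOp HSpace.shift
    simp only [mem_conj_graph, LinearIsometryEquiv.symm_trans, LinearIsometryEquiv.trans_apply,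
      LinearIsometryEquiv.symm_symm, LinearIsometryEquiv.symm_apply_apply]

lemma inH_leftDefiniteOp_domain_eq_image (r s : ℝ≥0) :
    ((inH (leftDefiniteOp A hA s)).domain : Set H) =
      {y | ∃ u : (rpow A (((r : ℝ) - s) / 2)).domain,
        (u : H) ∈ (inH (leftDefiniteOp A hA r)).domain ∧
          rpow A (((r : ℝ) - s) / 2) u = y} := by
  have hg := fun h => rpow_sub_mem_graph hA (a := (r : ℝ) / 2) (b := (s : ℝ) / 2)
    (c := ((r : ℝ) - s) / 2) (by positivity) (by positivity) (sub_div _ _ _) h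
  ext y
  rw [inH_leftDefiniteOp_domain, inH_leftDefiniteOp_domain, SetLike.mem_coe,
    mem_V_add_two_iff hA, Set.mem_ofPred_eq]
  simp only [mem_V_add_two_iff hA]
  constructor
  · rintro ⟨h, rfl⟩
    obtain ⟨u, hu, hu'⟩ := (LinearPMap.mem_graph_iff _).mp (hg (boundedInverse A h))
    exact ⟨u, ⟨h, hu.symm⟩, hu'⟩
  · rintro ⟨u, ⟨h, hu⟩, rfl⟩
    exact ⟨h, LinearPMap.mem_graph_snd_inj _ (hg (boundedInverse A h))
      ((rpow A _).mem_graph u) hu⟩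

end Scale

end LeftDefinite

end

open LeftDefinite
theorem theorem2p3 {H : Type u} [NormedAddCommGroup H] [InnerProductSpace ℂ H] [CompleteSpace H]
    (A : H →ₗ.[ℂ] H) (hA : IsSelfAdjointGeOne A) :
    ∃ Aop : ∀ r : ℝ≥0, HSpace A hA r →ₗ.[ℂ] HSpace A hA r,
      -- `A_r` is a self-adjoint operator in `H_r(A)`, `dom A_r = V_{r+2}(A)`, `A_r = A|V_{r+2}(A)`
      (∀ r, IsSelfAdjoint (Aop r) ∧
        (inH (Aop r)).domain = V A (r + 2) ∧
        inH (Aop r) = A.domRestrict (V A (r + 2))) ∧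
      -- it is the only self-adjoint operator in `H_r(A)` that is a restriction of `A`
      (∀ r, ∀ T : HSpace A hA r →ₗ.[ℂ] HSpace A hA r,
        IsSelfAdjoint T → inH T ≤ A → T = Aop r) ∧
      -- `H_0(A) = H`, `V_2(A) = dom A`, `A_0 = A`
      (V A 0 = ⊤ ∧
        (∀ x y : HSpace A hA 0, ⟪x, y⟫_ℂ =
          ⟪HSpace.incl A hA 0 x, HSpace.incl A hA 0 y⟫_ℂ) ∧
        V A 2 = A.domain ∧
        inH (Aop 0) = A) ∧
      -- the domains are nested, strictly if `A` is unbounded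
      (∀ r, (inH (Aop r)).domain ≤ A.domain) ∧
      (∀ r s, r < s →
        (inH (Aop s)).domain ≤ (inH (Aop r)).domain) ∧
      (¬ IsBoundedOp A →
        (∀ r, 0 < r → (inH (Aop r)).domain < A.domain) ∧
        (∀ r s, r < s →
          (inH (Aop s)).domain < (inH (Aop r)).domain)) ∧
      -- if `A` is bounded, all spaces and operators agree, with equivalent norms
      (IsBoundedOp A →
        (∀ r, V A r = ⊤ ∧ inH (Aop r) = A) ∧
        (∀ r s, ∃ c C : ℝ, 0 < c ∧ 0 < C ∧
          ∀ (u : HSpace A hA r) (v : HSpace A hA s),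
            HSpace.incl A hA r u = HSpace.incl A hA s v →
            c * ‖v‖ ≤ ‖u‖ ∧ ‖u‖ ≤ C * ‖v‖) ∧
        (∀ r, ∃ c C : ℝ, 0 < c ∧ 0 < C ∧ ∀ u : HSpace A hA r,
            c * ‖HSpace.incl A hA r u‖ ≤ ‖u‖ ∧
            ‖u‖ ≤ C * ‖HSpace.incl A hA r u‖)) ∧
      -- `A ^ ((r - s) / 2)` is a unitary map from `H_{r+t}(A)` onto `H_{s+t}(A)`
      (∀ r s t : ℝ≥0,
        ∃ U : HSpace A hA (r + t) ≃ₗᵢ[ℂ] HSpace A hA (s + t),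
          IsPowerMap (((r : ℝ) - s) / 2) U) ∧
      -- `A ^ ((r - s) / 2) A_r A ^ (-(r - s) / 2) = A_s`
      (∀ r s : ℝ≥0, ∃ U : HSpace A hA r ≃ₗᵢ[ℂ] HSpace A hA s,
        IsPowerMap (((r : ℝ) - s) / 2) U ∧
        IsPowerMap (-(((r : ℝ) - s) / 2)) U.symm ∧
        conj U (Aop r) = Aop s) ∧
      -- `dom A_s = A ^ ((r - s) / 2) dom A_r`
      (∀ r s : ℝ≥0, ((inH (Aop s)).domain : Set H) =
        {y | ∃ u : (rpow A (((r : ℝ) - s) / 2)).domain,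
          (u : H) ∈ (inH (Aop r)).domain ∧
            rpow A (((r : ℝ) - s) / 2) u = y}) ∧
      -- all `A_r` are unitarily equivalent to `A`, and all unitary invariants coincide
      (∀ r, ∃ U : HSpace A hA r ≃ₗᵢ[ℂ] H, conj U (Aop r) = A) ∧
      (∀ (α : Type v)
        (Φ : ∀ (K : Type u) [NormedAddCommGroup K] [InnerProductSpace ℂ K] [CompleteSpace K],
          (K →ₗ.[ℂ] K) → α), IsUnitaryInvariant Φ →
        (∀ r s, Φ (HSpace A hA r) (Aop r) =
          Φ (HSpace A hA s) (Aop s)) ∧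
        (∀ r, Φ (HSpace A hA r) (Aop r) = Φ H A)) := by
  refine ⟨leftDefiniteOp A hA, fun r => ⟨isSelfAdjoint_leftDefiniteOp r,
    inH_leftDefiniteOp_domain r, inH_leftDefiniteOp r⟩, fun r T => eq_leftDefiniteOp,
    ⟨V_zero hA, inner_HSpace_zero, V_two hA,
      inH_leftDefiniteOp_eq_of_V_eq (by rw [zero_add, V_two hA])⟩,
    fun r => (inH_leftDefiniteOp_le r).1, ?_, ?_, ?_, ?_, ?_,
    inH_leftDefiniteOp_domain_eq_image, fun r => ⟨(HSpace.ofBase A hA r).symm,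
      conj_symm_conj _ A⟩, ?_⟩
  · intro r s hrs
    rw [inH_leftDefiniteOp_domain, inH_leftDefiniteOp_domain]
    exact V_antitone hA (by gcongr)
  · refine fun hb => ⟨fun r hr => ?_, fun r s hrs => ?_⟩
    · rw [inH_leftDefiniteOp_domain, ← V_two hA]
      exact V_strictAnti hA hb (lt_add_of_pos_left 2 hr)
    · rw [inH_leftDefiniteOp_domain, inH_leftDefiniteOp_domain]
      exact V_strictAnti hA hb (by gcongr)
  · refine fun hb => ⟨fun r => ⟨V_eq_top hA hb r, inH_leftDefiniteOp_eq_of_V_eq ?_⟩,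
      fun r s => ?_, norm_HSpace_equiv hb⟩
    · rw [← V_two hA, V_eq_top hA hb, V_eq_top hA hb]
    · obtain ⟨c, C, hc, hC, hr⟩ := norm_HSpace_equiv (hA := hA) hb r
      obtain ⟨d, D, hd, hD, hs⟩ := norm_HSpace_equiv (hA := hA) hb s
      refine ⟨c / D, C / d, div_pos hc hD, div_pos hC hd, fun u v huv => ?_⟩
      have hu := hr u
      rw [huv] at hu
      constructor
      · rw [div_mul_eq_mul_div, mul_div_assoc]
        exact (mul_le_mul_of_nonneg_left ((div_le_iff₀' hD).mpr (hs v).2) hc.le).trans hu.1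
      · rw [div_mul_eq_mul_div, mul_div_assoc]
        exact hu.2.trans (mul_le_mul_of_nonneg_left ((le_div_iff₀' hd).mpr (hs v).1) hC.le)
  · exact fun r s t => ⟨HSpace.shift A hA (r + t) (s + t),
      isPowerMap_shift (by push_cast; ring)⟩
  · exact fun r s => ⟨HSpace.shift A hA r s, isPowerMap_shift rfl,
      isPowerMap_shift (p := s) (q := r) (by ring), conj_shift r s⟩
  · intro α Φ hΦ
    have hbase : ∀ r, Φ (HSpace A hA r) (leftDefiniteOp A hA r) = Φ H A :=
      fun r => hΦ H (HSpace A hA r) (HSpace.ofBase A hA r) A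
    exact ⟨fun r s => (hbase r).trans (hbase s).symm, hbase⟩
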